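/- Let $\mathbb{Q}_{p\to\infty}$ be the commutative $\mathbb{Q}$-algebra $$\mathbb{Q}_{p\to\infty}=\frac{\{(a_p)\in\prod_p\mathbb{Q}_p : v_p(a_p)\text{ bounded below}\}}{\{(a_p)\in\prod_p\mathbb{Q}_p : v_p(a_p)\to\infty\text{ as }p\to\infty\}},$$ where $p$ runs over all primes, with the topology in which the sets $\mathrm{Fil}^n=\{(a_p): a_p\in p^n\mathbb{Z}_p\text{ for all but finitely many }p\}$, $n\in\mathbb{Z}$, form a neighbourhood basis of $0$. A composition is a finite (possibly empty) list $\mathbf{s}=(s_1,\ldots,s_k)$ of positive integers, and $H_N(\mathbf{s})=\sum_{N\ge n_1>\cdots>n_k\ge1}\frac{1}{n_1^{s_1}\cdots n_k^{s_k}}$, which is $1$ for the empty composition. The MHS algebra $\mathcal{M}\subset\mathbb{Q}_{p\to\infty}$ is the set of elements of the form $\sum_{i\ge1}\left(c_i\,p^{b_i}H_{p-1}(\mathbf{s}_i)\right)$ with $c_i\in\mathbb{Q}$, integers $b_i\to\infty$, and compositions $\mathbf{s}_i$, all independent of $p$. Theorem. Let $f(x),g(x)\in\mathbb{Z}[x]$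 have positive leading coefficients. If $f=g$ or $f-g$ has positive leading coefficient (equivalently, $f(p)\ge g(p)$ for all sufficiently large $p$), then the element $\binom{f(p)}{g(p)}$ of $\mathbb{Q}_{p\to\infty}$ is a unit in the MHS algebra: it lies in $\mathcal{M}$ and has an inverse in $\mathcal{M}$. Otherwise $\binom{f(p)}{g(p)}=0$ in $\mathbb{Q}_{p\to\infty}$. -/

import Mathlib

namespace MHS

open Filter Polynomial

instance factPrime (p : Nat.Primes) : Fact (p : ℕ).Prime := ⟨p.2⟩

/-- The product `∏_p ℚ_p` over all primes. -/
abbrev PadicFamily : Type := (p : Nat.Primes) → ℚ_[(p : ℕ)]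

/-- `v_p(x) ≥ n`, i.e. `x ∈ p^n ℤ_p`, with the convention `v_p(0) = ∞`. -/
def ValGE (p : Nat.Primes) (x : ℚ_[(p : ℕ)]) (n : ℤ) : Prop :=
  ‖x‖ ≤ ((p : ℕ) : ℝ) ^ (-n)

theorem ValGE.mono {p : Nat.Primes} {x : ℚ_[(p : ℕ)]} {m n : ℤ} (h : ValGE p x n)
    (hmn : m ≤ n) : ValGE p x m :=
  h.trans (zpow_le_zpow_right₀ (by exact_mod_cast p.2.one_lt.le) (by omega))

theorem ValGE.zero (p : Nat.Primes) (n : ℤ) : ValGE p 0 n := by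
  unfold ValGE
  rw [norm_zero]
  positivity

theorem ValGE.add {p : Nat.Primes} {x y : ℚ_[(p : ℕ)]} {n : ℤ} (hx : ValGE p x n)
    (hy : ValGE p y n) : ValGE p (x + y) n :=
  (Padic.nonarchimedean x y).trans (max_le hx hy)

theorem ValGE.mul {p : Nat.Primes} {x y : ℚ_[(p : ℕ)]} {m n : ℤ} (hx : ValGE p x m)
    (hy : ValGE p y n) : ValGE p (x * y) (m + n) := by
  unfold ValGE at *
  have hp : ((p : ℕ) : ℝ) ≠ 0 := by exact_mod_cast p.2.ne_zero
  rw [norm_mul, neg_add, zpow_add₀ hp]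
  exact mul_le_mul hx hy (norm_nonneg _) (by positivity)

theorem ValGE.ratCast (p : Nat.Primes) (q : ℚ) : ValGE p (q : ℚ_[(p : ℕ)]) (-(q.den : ℤ)) := by
  by_cases hq : q = 0
  · subst hq
    simpa using ValGE.zero p (-1)
  · unfold ValGE
    have hq' : (q : ℚ_[(p : ℕ)]) ≠ 0 := by exact_mod_cast hq
    rw [Padic.norm_eq_zpow_neg_valuation hq', Padic.valuation_ratCast]
    refine zpow_le_zpow_right₀ (by exact_mod_cast p.2.one_lt.le) ?_
    unfold padicValRat
    have h1 : padicValNat p q.den ≤ q.den :=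
      (padicValNat_le_nat_log q.den).trans (Nat.log_le_self _ _)
    omega

/-- The families `(a_p) ∈ ∏_p ℚ_p` for which `v_p(a_p)` is bounded below. -/
def boundedFamilies : Subalgebra ℚ PadicFamily where
  carrier := {a | ∃ n : ℤ, ∀ p, ValGE p (a p) n}
  mul_mem' := by
    rintro a b ⟨m, hm⟩ ⟨n, hn⟩
    exact ⟨m + n, fun p => (hm p).mul (hn p)⟩
  add_mem' := by
    rintro a b ⟨m, hm⟩ ⟨n, hn⟩
    exact ⟨min m n, fun p =>
      ((hm p).mono (min_le_left _ _)).add ((hn p).mono (min_le_right _ _))⟩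
  algebraMap_mem' q := ⟨-(q.den : ℤ), fun p => by
    simpa using ValGE.ratCast p q⟩

/-- The families for which `v_p(a_p) → ∞` as `p → ∞`. -/
def nullFamilies : Ideal boundedFamilies where
  carrier := {a | ∀ n : ℤ, ∀ᶠ p in cofinite, ValGE p (a.1 p) n}
  zero_mem' n := Eventually.of_forall fun p => ValGE.zero p n
  add_mem' := by
    intro a b ha hb n
    filter_upwards [ha n, hb n] with p h1 h2
    exact h1.add h2
  smul_mem' := by
    rintro ⟨c, m, hm⟩ a ha n
    filter_upwards [ha (n - m)] with p hp
    have h := (hm p).mul hp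
    rwa [add_sub_cancel] at h

/-- The ring `ℚ_{p → ∞}`. -/
abbrev QInf : Type := boundedFamilies ⧸ nullFamilies

/-- The class in `ℚ_{p → ∞}` of a family with `v_p(a_p)` bounded below. -/
noncomputable def classOf (a : PadicFamily) (ha : ∃ n : ℤ, ∀ p, ValGE p (a p) n) : QInf :=
  Ideal.Quotient.mk nullFamilies ⟨a, ha⟩

/-- `Fil^n ℚ_{p → ∞}`: the classes of the families with `a_p ∈ p^n ℤ_p` for all but finitely
many `p`. -/
def Fil (n : ℤ) : Set QInf :=
  {x | ∃ (a : PadicFamily) (ha : ∃ m : ℤ, ∀ p, ValGE p (a p) m),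
    x = classOf a ha ∧ ∀ᶠ p in cofinite, ValGE p (a p) n}

/-- `x = ∑_{i ≥ 0} u i` in the topology of `ℚ_{p → ∞}` in which the sets `Fil n` form a
neighbourhood basis of `0`. -/
def IsSeriesSum (u : ℕ → QInf) (x : QInf) : Prop :=
  ∀ n : ℤ, ∀ᶠ N in atTop, x - ∑ i ∈ Finset.range N, u i ∈ Fil n

/-- The multiple harmonic sum
`H_N(s₁, …, s_k) = ∑_{N ≥ n₁ > ⋯ > n_k ≥ 1} 1 / (n₁ ^ s₁ ⋯ n_k ^ s_k)`,
by summation over `n₁` first; the empty composition gives `1`. -/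
def H : ℕ → List ℕ+ → ℚ
  | _, [] => 1
  | N, s :: t => ∑ n ∈ Finset.Icc 1 N, 1 / (n : ℚ) ^ (s : ℕ) * H (n - 1) t

theorem norm_H_le_one (p : Nat.Primes) (s : List ℕ+) :
    ∀ N : ℕ, N < p → ‖((H N s : ℚ) : ℚ_[(p : ℕ)])‖ ≤ 1 := by
  induction s with
  | nil => intro N _; simp [H]
  | cons s t ih =>
    intro N hN
    rw [H, Rat.cast_sum]
    refine IsUltrametricDist.norm_sum_le_of_forall_le_of_nonneg zero_le_one fun n hn => ?_
    rw [Finset.mem_Icc] at hn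
    have hn1 : ‖((n : ℕ) : ℚ_[(p : ℕ)])‖ = 1 := by
      rw [Padic.norm_natCast_eq_one_iff]
      exact (Nat.Prime.coprime_iff_not_dvd p.2).2 fun h =>
        absurd (Nat.le_of_dvd (by omega) h) (by omega)
    push_cast
    rw [norm_mul, norm_div, norm_pow, hn1]
    simpa using ih (n - 1) (by omega)

/-- The element `(p^b)` of `ℚ_{p → ∞}`. -/
noncomputable def pPow (b : ℤ) : QInf :=
  classOf (fun p => ((p : ℕ) : ℚ_[(p : ℕ)]) ^ b)
    ⟨b, fun p => (Padic.norm_p_zpow (p := (p : ℕ)) b).le⟩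

/-- The element `(H_{p-1}(s))` of `ℚ_{p → ∞}`. -/
noncomputable def hSum (s : List ℕ+) : QInf :=
  classOf (fun p => ((H ((p : ℕ) - 1) s : ℚ) : ℚ_[(p : ℕ)]))
    ⟨0, fun p => by
      simpa [ValGE] using norm_H_le_one p s ((p : ℕ) - 1) (Nat.sub_lt p.2.pos one_pos)⟩

/-- The MHS algebra, as a subset of `ℚ_{p → ∞}`: the sums of series
`∑_i c_i p^{b_i} H_{p-1}(s_i)` with `c_i ∈ ℚ`, integers `b_i → ∞`, and compositions `s_i`. -/
def mhsAlgebra : Set QInf :=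
  {x | ∃ (c : ℕ → ℚ) (b : ℕ → ℤ) (s : ℕ → List ℕ+),
    Tendsto b atTop atTop ∧ IsSeriesSum (fun i => c i • (pPow (b i) * hSum (s i))) x}

/-- `x` is a unit in the MHS algebra: it lies there and has an inverse there. -/
def IsMhsUnit (x : QInf) : Prop :=
  x ∈ mhsAlgebra ∧ ∃ y ∈ mhsAlgebra, x * y = 1

/-- The class of the binomial coefficients `f(p) choose g(p)`. When `f` and `g` have positive
leading coefficients, `f(p)` and `g(p)` are positive for all but finitely many `p`, and the
remaining components do not affect the class. -/
noncomputable def binom (f g : ℤ[X]) : QInf :=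
  classOf
    (fun p => ((Nat.choose (f.eval ((p : ℕ) : ℤ)).toNat (g.eval ((p : ℕ) : ℤ)).toNat : ℕ) :
      ℚ_[(p : ℕ)]))
    ⟨0, fun p => by
      simpa [ValGE] using Padic.norm_int_le_one (p := (p : ℕ))
        ((Nat.choose (f.eval ((p : ℕ) : ℤ)).toNat (g.eval ((p : ℕ) : ℤ)).toNat : ℕ) : ℤ)⟩

end MHS

namespace MHS

open Filter Polynomial

/-! ### The filtration on families -/

/-! Splitting the integers from 1 to pk into k blocks of length p gives (pk)! = k! · (p·(p-1)!)^k ·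
B(k), where B(k) is the product of 1 + pj/i over j < k and 0 < i < p. In a quotient (g+h)!/(g! h!)
of factorials of multiples of p, the middle factor, whose exponent may vary with p, cancels because
exponents add. What remains is the same quotient for g/p and h/p, times factors B.

The factor B is a unit. The product of 1 + X/i over 0 < i < p is the generating series E of the
H_{p-1}(1,…,1), and B(k) is the product of the E(jX), j < k, at X = p. Each coefficient of that
product is a polynomial in k, by Faulhaber summation (`exists_coeff_prod_rescale`), so k = f(p) may
be substituted. This gives a series in powers of p with constant term 1, whose coefficients are
finite combinations of p^b H_{p-1}(s), and such a series can be inverted (`IsExpansion.inv`). These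
combinations form an algebra by the quasi-shuffle product (`H_mul_H_mem_hSpan`).

Changing the constant term of f multiplies f(p)! by finitely many nonzero polynomials in p or their
inverses, and these are units too (`isMhsUnitFamily_aeval`). So one may pass from f to X · `f.divX`,
and induction on the degree gives `isMhsUnitFamily_multinomial`. A series in p with such
coefficients is finally rearranged into the single series required by `mhsAlgebra`
(`IsMhsFamily.classOf_mem`).

If f - g has negative leading coefficient, then f(p) < g(p) for almost all p and the binomial
coefficient vanishes. -/

theorem eventually_lt_prime (n : ℕ) : ∀ᶠ p : Nat.Primes in cofinite, n < (p : ℕ) := by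
  have h : Tendsto (fun p : Nat.Primes => (p : ℕ)) cofinite atTop := by
    rw [← Nat.cofinite_eq_atTop]
    exact Nat.Primes.coe_nat_injective.tendsto_cofinite
  exact h.eventually_gt_atTop n

theorem prime_cast_ne_zero (p : Nat.Primes) : ((p : ℕ) : ℚ_[(p : ℕ)]) ≠ 0 := by
  exact_mod_cast p.2.ne_zero

theorem valGE_zero_iff {p : Nat.Primes} {x : ℚ_[(p : ℕ)]} : ValGE p x 0 ↔ ‖x‖ ≤ 1 := by
  simp [ValGE]

/-- Only the finitely many primes dividing the denominator can fail; this is what makes each `famFil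
n` a rational subspace. -/
theorem ratCast_valGE_zero (c : ℚ) :
    ∀ᶠ p : Nat.Primes in cofinite, ValGE p (c : ℚ_[(p : ℕ)]) 0 := by
  filter_upwards [eventually_lt_prime c.den] with p hp
  rw [valGE_zero_iff]
  exact Padic.norm_rat_le_one fun h => absurd (Nat.le_of_dvd c.pos h) (by omega)

/-- The families whose components lie in `p ^ n ℤ_p` for all but finitely many `p`. -/
def famFil (n : ℤ) : Submodule ℚ PadicFamily where
  carrier := {a | ∀ᶠ p in cofinite, ValGE p (a p) n}
  zero_mem' := by
    rw [Set.mem_ofPred_eq]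
    exact Eventually.of_forall fun p => ValGE.zero p n
  add_mem' := by
    intro a b ha hb
    rw [Set.mem_ofPred_eq] at *
    filter_upwards [ha, hb] with p h1 h2
    exact h1.add h2
  smul_mem' := by
    intro c a ha
    rw [Set.mem_ofPred_eq] at *
    filter_upwards [ratCast_valGE_zero c, ha] with p h1 h2
    have h := h1.mul h2
    rw [zero_add] at h
    simpa [Algebra.smul_def] using h

theorem mem_famFil {n : ℤ} {a : PadicFamily} :
    a ∈ famFil n ↔ ∀ᶠ p in cofinite, ValGE p (a p) n := Iff.rfl

theorem famFil_mono {m n : ℤ} (h : m ≤ n) : famFil n ≤ famFil m := fun a ha => by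
  rw [mem_famFil] at *
  exact ha.mono fun p hp => hp.mono h

theorem mul_mem_famFil {m n : ℤ} {a b : PadicFamily} (ha : a ∈ famFil m) (hb : b ∈ famFil n) :
    a * b ∈ famFil (m + n) := by
  rw [mem_famFil] at *
  filter_upwards [ha, hb] with p h1 h2
  exact h1.mul h2

theorem mul_mem_famFil_of_left {n : ℤ} {a b : PadicFamily} (ha : a ∈ famFil 0)
    (hb : b ∈ famFil n) : a * b ∈ famFil n := by
  simpa using mul_mem_famFil ha hb

theorem famFil_congr {n : ℤ} {a b : PadicFamily} (h : ∀ᶠ p in cofinite, a p = b p)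
    (ha : a ∈ famFil n) : b ∈ famFil n := by
  rw [mem_famFil] at *
  filter_upwards [h, ha] with p h1 h2
  rwa [← h1]

/-- The family `(p)`. -/
noncomputable def pFam : PadicFamily := fun p => ((p : ℕ) : ℚ_[(p : ℕ)])

/-- The family `(H_{p-1}(s))`. -/
noncomputable def hFam (s : List ℕ+) : PadicFamily := fun p =>
  ((H ((p : ℕ) - 1) s : ℚ) : ℚ_[(p : ℕ)])

theorem pFam_pow_mem_famFil (n : ℕ) : pFam ^ n ∈ famFil n := by
  rw [mem_famFil]
  refine Eventually.of_forall fun p => ?_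
  have := (Padic.norm_p_zpow (p := (p : ℕ)) (n : ℤ)).le
  rw [zpow_natCast] at this
  exact this

theorem hFam_mem_famFil (s : List ℕ+) : hFam s ∈ famFil 0 :=
  mem_famFil.2 <| Eventually.of_forall fun p => valGE_zero_iff.2
    (norm_H_le_one p s ((p : ℕ) - 1) (Nat.sub_lt p.2.pos one_pos))

theorem hFam_nil : hFam [] = 1 := by
  ext p
  simp [hFam, H]

/-! ### Products of multiple harmonic sums -/

theorem H_zero_cons (a : ℕ+) (s : List ℕ+) : H 0 (a :: s) = 0 := by simp [H]

theorem H_succ_cons (N : ℕ) (a : ℕ+) (s : List ℕ+) :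
    H (N + 1) (a :: s) = H N (a :: s) + 1 / ((N + 1 : ℕ) : ℚ) ^ (a : ℕ) * H N s := by
  rw [H, H, Finset.sum_Icc_succ_top (by omega)]
  simp

/-- The span of the functions `N ↦ H_N(s)`. -/
def hSpan : Submodule ℚ (ℕ → ℚ) := Submodule.span ℚ (Set.range fun s N => H N s)

/-- The operator `F ↦ (N ↦ ∑_{n ≤ N} n ^ (-a) F(n - 1))`. -/
def harmonicSum (a : ℕ+) : (ℕ → ℚ) →ₗ[ℚ] (ℕ → ℚ) where
  toFun F N := ∑ n ∈ Finset.Icc 1 N, 1 / (n : ℚ) ^ (a : ℕ) * F (n - 1)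
  map_add' F G := by
    ext N
    simp [mul_add, Finset.sum_add_distrib]
  map_smul' c F := by
    ext N
    simp only [Pi.smul_apply, smul_eq_mul, RingHom.id_apply, Finset.mul_sum]
    exact Finset.sum_congr rfl fun n _ => by ring

theorem harmonicSum_zero (a : ℕ+) (F : ℕ → ℚ) : harmonicSum a F 0 = 0 := by simp [harmonicSum]

theorem harmonicSum_succ (a : ℕ+) (F : ℕ → ℚ) (N : ℕ) :
    harmonicSum a F (N + 1) = harmonicSum a F N + 1 / ((N + 1 : ℕ) : ℚ) ^ (a : ℕ) * F N := by
  simp only [harmonicSum, LinearMap.coe_mk, AddHom.coe_mk]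
  rw [Finset.sum_Icc_succ_top (by omega)]
  simp

theorem harmonicSum_mem_hSpan (a : ℕ+) {F : ℕ → ℚ} (hF : F ∈ hSpan) :
    harmonicSum a F ∈ hSpan := by
  have h : hSpan ≤ hSpan.comap (harmonicSum a) := by
    refine Submodule.span_le.2 ?_
    rintro _ ⟨s, rfl⟩
    exact Submodule.subset_span ⟨a :: s, by ext N; simp [harmonicSum, H]⟩
  exact h hF

/-- Quasi-shuffle product: the three recursive terms correspond to the largest index of the first
sum being greater than, less than, or equal to that of the second. The identity is checked by
comparing increments in N. -/
theorem H_mul_H_mem_hSpan (s t : List ℕ+) : (fun N => H N s * H N t) ∈ hSpan := by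
  match s, t with
  | [], t => exact Submodule.subset_span ⟨t, by ext N; simp [H]⟩
  | a :: s, [] => exact Submodule.subset_span ⟨a :: s, by ext N; simp [H]⟩
  | a :: s, b :: t =>
    have h1 := harmonicSum_mem_hSpan a (H_mul_H_mem_hSpan s (b :: t))
    have h2 := harmonicSum_mem_hSpan b (H_mul_H_mem_hSpan (a :: s) t)
    have h3 := harmonicSum_mem_hSpan (a + b) (H_mul_H_mem_hSpan s t)
    convert hSpan.add_mem (hSpan.add_mem h1 h2) h3 using 1
    ext N
    simp only [Pi.add_apply]
    induction N with
    | zero => simp [harmonicSum_zero, H_zero_cons]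
    | succ N ih =>
      rw [harmonicSum_succ, harmonicSum_succ, harmonicSum_succ, H_succ_cons, H_succ_cons]
      rw [PNat.add_coe, pow_add, ← one_div_mul_one_div]
      linear_combination ih
termination_by s.length + t.length

/-! ### Finite combinations of powers of `p` and multiple harmonic sums -/

/-- The span of the families `p ^ b H_{p-1}(s)`, `b ≥ 0`. -/
noncomputable def mhsSpan : Submodule ℚ PadicFamily :=
  Submodule.span ℚ (Set.range fun i : ℕ × List ℕ+ => pFam ^ i.1 * hFam i.2)

theorem pFam_pow_mul_hFam_mul_hFam_mem (b : ℕ) (s t : List ℕ+) :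
    pFam ^ b * (hFam s * hFam t) ∈ mhsSpan := by
  -- Substituting N = p - 1 is linear, so relations between functions of N transfer to families.
  let T : (ℕ → ℚ) →ₗ[ℚ] PadicFamily :=
    { toFun := fun F => pFam ^ b * (fun p => ((F ((p : ℕ) - 1) : ℚ) : ℚ_[(p : ℕ)]) : PadicFamily)
      map_add' := fun F G => by ext p; simp [mul_add]
      map_smul' := fun c F => by
        ext p
        simp [Algebra.smul_def]
        ring }
  have h : hSpan ≤ mhsSpan.comap T := by
    refine Submodule.span_le.2 ?_
    rintro _ ⟨s, rfl⟩
    exact Submodule.subset_span ⟨(b, s), rfl⟩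
  have hT : T (fun N => H N s * H N t) = pFam ^ b * (hFam s * hFam t) := by
    ext p
    simp [T, hFam]
  rw [← hT]
  exact h (H_mul_H_mem_hSpan s t)

theorem one_mem_mhsSpan : (1 : PadicFamily) ∈ mhsSpan :=
  Submodule.subset_span ⟨(0, []), by simp [hFam_nil]⟩

theorem mul_mem_mhsSpan (x y : PadicFamily) (hx : x ∈ mhsSpan) (hy : y ∈ mhsSpan) :
    x * y ∈ mhsSpan := by
  have h := Submodule.mul_mem_mul hx hy
  rw [mhsSpan, Submodule.span_mul_span] at h
  refine Submodule.span_le.2 ?_ h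
  rintro _ ⟨_, ⟨⟨b, s⟩, rfl⟩, _, ⟨⟨c, t⟩, rfl⟩, rfl⟩
  have h := pFam_pow_mul_hFam_mul_hFam_mem (b + c) s t
  rw [pow_add, mul_mul_mul_comm] at h
  exact h

/-- The algebra of finite combinations of the families `p ^ b H_{p-1}(s)`, `b ≥ 0`. -/
noncomputable def mhsPoly : Subalgebra ℚ PadicFamily :=
  mhsSpan.toSubalgebra one_mem_mhsSpan mul_mem_mhsSpan

theorem mhsPoly_le_famFil {a : PadicFamily} (ha : a ∈ mhsPoly) : a ∈ famFil 0 := by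
  have h : mhsSpan ≤ famFil 0 := by
    refine Submodule.span_le.2 ?_
    rintro _ ⟨⟨b, s⟩, rfl⟩
    exact mul_mem_famFil_of_left (famFil_mono (by omega) (pFam_pow_mem_famFil b))
      (hFam_mem_famFil s)
  exact h ha

theorem pFam_mem_mhsPoly : pFam ∈ mhsPoly :=
  Submodule.subset_span ⟨(1, []), by simp [hFam_nil]⟩

theorem hFam_mem_mhsPoly (s : List ℕ+) : hFam s ∈ mhsPoly :=
  Submodule.subset_span ⟨(0, s), by simp⟩

/-- The family `(p)` as an element of `mhsPoly`. -/
noncomputable def pElt : mhsPoly := ⟨pFam, pFam_mem_mhsPoly⟩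

/-! ### Expansions in powers of `p` -/

/-- `a = ∑_n p ^ n φ_n`, where `φ_n` are the coefficients of `φ`. -/
def IsExpansion (φ : PowerSeries mhsPoly) (a : PadicFamily) : Prop :=
  ∀ N : ℕ, a - ((PowerSeries.trunc N φ).eval pElt : mhsPoly) ∈ famFil N

theorem eval_pElt_mem_famFil {N : ℕ} {P : mhsPoly[X]} (h : X ^ N ∣ P) :
    ((P.eval pElt : mhsPoly) : PadicFamily) ∈ famFil N := by
  obtain ⟨Q, rfl⟩ := h
  rw [eval_mul, eval_pow, eval_X, mul_comm]
  exact mul_mem_famFil_of_left (mhsPoly_le_famFil (Q.eval pElt).2) (pFam_pow_mem_famFil N)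

theorem X_pow_dvd_trunc_mul_sub {R : Type*} [CommRing R] (N : ℕ) (φ ψ : PowerSeries R) :
    (X : R[X]) ^ N ∣
      PowerSeries.trunc N φ * PowerSeries.trunc N ψ - PowerSeries.trunc N (φ * ψ) := by
  rw [X_pow_dvd_iff]
  intro d hd
  rw [coeff_sub, coeff_mul, PowerSeries.coeff_trunc, if_pos hd, PowerSeries.coeff_mul, sub_eq_zero]
  refine Finset.sum_congr rfl fun x hx => ?_
  rw [Finset.HasAntidiagonal.mem_antidiagonal] at hx
  rw [PowerSeries.coeff_trunc, PowerSeries.coeff_trunc, if_pos (by omega), if_pos (by omega)]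

theorem trunc_mul_trunc_sub_mem (N : ℕ) (φ ψ : PowerSeries mhsPoly) :
    (((PowerSeries.trunc N φ).eval pElt : mhsPoly) : PadicFamily) *
      ((PowerSeries.trunc N ψ).eval pElt : mhsPoly) -
      ((PowerSeries.trunc N (φ * ψ)).eval pElt : mhsPoly) ∈ famFil N := by
  have h := eval_pElt_mem_famFil (X_pow_dvd_trunc_mul_sub N φ ψ)
  rw [eval_sub, eval_mul] at h
  exact h

theorem IsExpansion.mem_famFil_zero {φ : PowerSeries mhsPoly} {a : PadicFamily}
    (h : IsExpansion φ a) : a ∈ famFil 0 := by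
  simpa using h 0

theorem IsExpansion.congr {φ : PowerSeries mhsPoly} {a b : PadicFamily}
    (h : IsExpansion φ a) (hab : ∀ᶠ p in cofinite, a p = b p) : IsExpansion φ b := by
  intro N
  refine famFil_congr ?_ (h N)
  filter_upwards [hab] with p hp
  simp [hp]

theorem IsExpansion.mul {φ ψ : PowerSeries mhsPoly} {a b : PadicFamily}
    (ha : IsExpansion φ a) (hb : IsExpansion ψ b) : IsExpansion (φ * ψ) (a * b) := by
  intro N
  have h1 := mul_mem_famFil_of_left ha.mem_famFil_zero (hb N)
  have h2 := mul_mem_famFil_of_left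
    (mhsPoly_le_famFil ((PowerSeries.trunc N ψ).eval pElt).2) (ha N)
  convert add_mem (add_mem h1 h2) (trunc_mul_trunc_sub_mem N φ ψ) using 1
  ring

theorem norm_eq_one_of_sub_one {p : Nat.Primes} {x : ℚ_[(p : ℕ)]} (h : ValGE p (x - 1) 1) :
    ‖x‖ = 1 := by
  have h1 : ‖x - 1‖ < 1 := by
    refine lt_of_le_of_lt h ?_
    rw [zpow_neg_one]
    exact inv_lt_one_of_one_lt₀ (by exact_mod_cast p.2.one_lt)
  have h2 := Padic.norm_eq_of_norm_add_lt_right (p := (p : ℕ)) (z1 := x) (z2 := -1)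
    (by rw [norm_neg, norm_one, ← sub_eq_add_neg]; exact h1)
  simpa using h2

theorem IsExpansion.eventually_norm_eq_one {φ : PowerSeries mhsPoly} {a : PadicFamily}
    (h : IsExpansion φ a) (hφ : PowerSeries.constantCoeff φ = 1) :
    ∀ᶠ p in cofinite, ‖a p‖ = 1 := by
  have h1 := h 1
  rw [PowerSeries.trunc_one_left, PowerSeries.coeff_zero_eq_constantCoeff_apply, hφ, map_one,
    eval_one] at h1
  filter_upwards [mem_famFil.1 h1] with p hp
  exact norm_eq_one_of_sub_one hp

/-- With truncations φ_N, ψ_N of φ and its inverse ψ, one has a⁻¹ - ψ_N = -a⁻¹ (ψ_N a - 1). The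
bracket is ψ_N (a - φ_N) + (φ_N ψ_N - 1), and a⁻¹ is integral for almost all p because a ≡ 1 mod p.
-/
theorem IsExpansion.inv {φ : PowerSeries mhsPoly} {a : PadicFamily}
    (h : IsExpansion φ a) (hφ : PowerSeries.constantCoeff φ = 1) :
    IsExpansion (φ.invOfUnit 1) a⁻¹ := by
  intro N
  have hnorm := h.eventually_norm_eq_one hφ
  have hinv : a⁻¹ ∈ famFil 0 := by
    rw [mem_famFil]
    filter_upwards [hnorm] with p hp
    rw [valGE_zero_iff, Pi.inv_apply, norm_inv, hp, inv_one]
  set ψ := φ.invOfUnit 1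
  have hφψ : φ * ψ = 1 := PowerSeries.mul_invOfUnit φ 1 (by simpa using hφ)
  have h1 := mul_mem_famFil_of_left
    (mhsPoly_le_famFil ((PowerSeries.trunc N ψ).eval pElt).2) (h N)
  have h2 := trunc_mul_trunc_sub_mem N φ ψ
  have h3 : (((PowerSeries.trunc N (1 : PowerSeries mhsPoly)).eval pElt : mhsPoly) : PadicFamily)
      - 1 ∈ famFil N := by
    rcases N with _ | N
    · simpa using neg_mem (mhsPoly_le_famFil (one_mem mhsPoly))
    · rw [PowerSeries.trunc_one, eval_one]
      simp
  rw [hφψ] at h2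
  have h4 := mul_mem_famFil_of_left hinv (neg_mem (add_mem (add_mem h1 h2) h3))
  refine famFil_congr ?_ h4
  filter_upwards [hnorm] with p hp
  have hap : a p ≠ 0 := by
    intro h0
    rw [h0, norm_zero] at hp
    exact zero_ne_one hp
  simp only [Pi.mul_apply, Pi.neg_apply, Pi.add_apply, Pi.sub_apply, Pi.inv_apply, Pi.one_apply]
  field_simp
  ring

/-- The families of the form `p ^ (-m) ∑_n p ^ n φ_n`. -/
def IsMhsFamily (a : PadicFamily) : Prop :=
  ∃ (m : ℕ) (φ : PowerSeries mhsPoly), IsExpansion φ (pFam ^ m * a)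

theorem IsMhsFamily.mul {a b : PadicFamily} (ha : IsMhsFamily a) (hb : IsMhsFamily b) :
    IsMhsFamily (a * b) := by
  obtain ⟨m, φ, hφ⟩ := ha
  obtain ⟨n, ψ, hψ⟩ := hb
  refine ⟨m + n, φ * ψ, ?_⟩
  convert hφ.mul hψ using 1
  rw [pow_add]
  ring

theorem IsMhsFamily.congr {a b : PadicFamily} (h : IsMhsFamily a)
    (hab : ∀ᶠ p in cofinite, a p = b p) : IsMhsFamily b := by
  obtain ⟨m, φ, hφ⟩ := h
  refine ⟨m, φ, hφ.congr ?_⟩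
  filter_upwards [hab] with p hp
  simp [hp]

theorem isExpansion_C (a : mhsPoly) : IsExpansion (PowerSeries.C a) a := by
  intro N
  rcases N with _ | N
  · simpa using mhsPoly_le_famFil a.2
  · rw [PowerSeries.trunc_C, eval_C, sub_self]
    exact zero_mem _

theorem isMhsFamily_of_mem {a : PadicFamily} (ha : a ∈ mhsPoly) : IsMhsFamily a :=
  ⟨0, PowerSeries.C ⟨a, ha⟩, by simpa using isExpansion_C ⟨a, ha⟩⟩

/-- The families that, together with their inverses, have expansions. -/
structure IsMhsUnitFamily (a : PadicFamily) : Prop where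
  mem : IsMhsFamily a
  inv_mem : IsMhsFamily a⁻¹
  ne_zero : ∀ᶠ p in cofinite, a p ≠ 0

theorem IsMhsUnitFamily.mul {a b : PadicFamily} (ha : IsMhsUnitFamily a)
    (hb : IsMhsUnitFamily b) : IsMhsUnitFamily (a * b) where
  mem := ha.mem.mul hb.mem
  inv_mem := by
    rw [mul_inv]
    exact ha.inv_mem.mul hb.inv_mem
  ne_zero := by
    filter_upwards [ha.ne_zero, hb.ne_zero] with p h1 h2
    exact mul_ne_zero h1 h2

theorem IsMhsUnitFamily.inv {a : PadicFamily} (ha : IsMhsUnitFamily a) :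
    IsMhsUnitFamily a⁻¹ where
  mem := ha.inv_mem
  inv_mem := by
    rw [inv_inv]
    exact ha.mem
  ne_zero := by
    filter_upwards [ha.ne_zero] with p hp
    exact inv_ne_zero hp

theorem IsMhsUnitFamily.congr {a b : PadicFamily} (ha : IsMhsUnitFamily a)
    (hab : ∀ᶠ p in cofinite, a p = b p) : IsMhsUnitFamily b where
  mem := ha.mem.congr hab
  inv_mem := ha.inv_mem.congr (by
    filter_upwards [hab] with p hp
    simp [hp])
  ne_zero := by
    filter_upwards [hab, ha.ne_zero] with p h1 h2
    rwa [← h1]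

theorem IsExpansion.isMhsUnitFamily {φ : PowerSeries mhsPoly} {a : PadicFamily}
    (h : IsExpansion φ a) (hφ : PowerSeries.constantCoeff φ = 1) : IsMhsUnitFamily a where
  mem := ⟨0, φ, by simpa using h⟩
  inv_mem := ⟨0, _, by simpa using h.inv hφ⟩
  ne_zero := by
    filter_upwards [h.eventually_norm_eq_one hφ] with p hp h0
    rw [h0, norm_zero] at hp
    exact zero_ne_one hp

theorem isMhsUnitFamily_pFam : IsMhsUnitFamily pFam where
  mem := isMhsFamily_of_mem pFam_mem_mhsPoly
  inv_mem := ⟨1, PowerSeries.C 1, (isExpansion_C 1).congr (Eventually.of_forall fun p => by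
    simp [pFam, mul_inv_cancel₀ (prime_cast_ne_zero p)])⟩
  ne_zero := Eventually.of_forall prime_cast_ne_zero

theorem isMhsUnitFamily_algebraMap {c : ℚ} (hc : c ≠ 0) :
    IsMhsUnitFamily (algebraMap ℚ PadicFamily c) where
  mem := isMhsFamily_of_mem (mhsPoly.algebraMap_mem c)
  inv_mem := (isMhsFamily_of_mem (mhsPoly.algebraMap_mem c⁻¹)).congr
    (Eventually.of_forall fun p => by simp)
  ne_zero := Eventually.of_forall fun p => by simpa using hc

theorem isMhsUnitFamily_one_add_pFam_mul {b : PadicFamily} (hb : b ∈ mhsPoly) :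
    IsMhsUnitFamily (1 + pFam * b) := by
  have h : IsExpansion (1 + PowerSeries.X * PowerSeries.C (⟨b, hb⟩ : mhsPoly)) (1 + pFam * b) := by
    intro N
    rcases N with _ | _ | N
    · simpa using mhsPoly_le_famFil (add_mem (one_mem _) (mul_mem pFam_mem_mhsPoly hb))
    · rw [PowerSeries.trunc_one_left]
      simpa using mul_mem_famFil (pFam_pow_mem_famFil 1) (mhsPoly_le_famFil hb)
    · convert zero_mem (famFil _)
      rw [sub_eq_zero]
      have : PowerSeries.trunc (N + 1 + 1)
          (1 + PowerSeries.X * PowerSeries.C (⟨b, hb⟩ : mhsPoly)) = 1 + X * C ⟨b, hb⟩ := by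
        ext n : 1
        rw [PowerSeries.coeff_trunc]
        rcases n with _ | _ | n
        · simp
        · simp [coeff_one, PowerSeries.coeff_one]
        · simp [coeff_one, PowerSeries.coeff_one, PowerSeries.coeff_X]
      rw [this]
      simp [pElt]
      exact mul_comm _ _
  exact h.isMhsUnitFamily (by simp)

theorem aeval_pFam_mem_mhsPoly (q : ℚ[X]) : aeval pFam q ∈ mhsPoly := by
  have h := aeval_algHom_apply mhsPoly.val pElt q
  exact h ▸ (aeval pElt q).2

/-- A nonzero polynomial in `p` is a unit. -/
theorem isMhsUnitFamily_aeval {q : ℚ[X]} (hq : q ≠ 0) : IsMhsUnitFamily (aeval pFam q) := by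
  induction hn : q.natDegree using Nat.strong_induction_on generalizing q with
  | _ n ih =>
    have hdiv := q.divX_mul_X_add
    by_cases h0 : q.coeff 0 = 0
    · rw [h0, C_0, add_zero] at hdiv
      have hd : q.divX ≠ 0 := by
        rintro h
        rw [h, zero_mul] at hdiv
        exact hq hdiv.symm
      have hdeg : q.natDegree = q.divX.natDegree + 1 := by
        conv_lhs => rw [← hdiv]
        exact natDegree_mul_X hd
      rw [← hdiv, map_mul, aeval_X]
      exact (ih _ (by omega) hd rfl).mul isMhsUnitFamily_pFam
    -- With c = q(0) ≠ 0, write q(p) = c (1 + p · c⁻¹ `q.divX`(p)).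
    · have h := (isMhsUnitFamily_algebraMap h0).mul (isMhsUnitFamily_one_add_pFam_mul
        (aeval_pFam_mem_mhsPoly (C (q.coeff 0)⁻¹ * q.divX)))
      convert h using 1
      conv_lhs => rw [← hdiv]
      rw [map_add, map_mul, map_mul, aeval_X, aeval_C, aeval_C, mul_add, mul_one, add_comm]
      congr 1
      have : algebraMap ℚ PadicFamily (q.coeff 0) * algebraMap ℚ PadicFamily (q.coeff 0)⁻¹ = 1 := by
        rw [← map_mul, mul_inv_cancel₀ h0, map_one]
      linear_combination (- aeval pFam q.divX * pFam) * this

/-! ### Products over an interval of polynomially varying length -/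

/-- Faulhaber's formula, monomial by monomial, with the Bernoulli polynomials mapped from ℚ to R. -/
theorem exists_eval_eq_sum_range {R : Type*} [CommRing R] [Algebra ℚ R] (q : R[X]) :
    ∃ S : R[X], ∀ k : ℕ, S.eval (k : R) = ∑ j ∈ Finset.range k, q.eval (j : R) := by
  induction q using Polynomial.induction_on' with
  | add q r hq hr =>
    obtain ⟨S, hS⟩ := hq
    obtain ⟨T, hT⟩ := hr
    exact ⟨S + T, fun k => by simp [hS, hT, Finset.sum_add_distrib]⟩
  | monomial n a =>
    let B : ℚ[X] := C ((n : ℚ) + 1)⁻¹ * (Polynomial.bernoulli n.succ - C (_root_.bernoulli n.succ))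
    have hB (k : ℕ) : B.eval (k : ℚ) = ∑ j ∈ Finset.range k, (j : ℚ) ^ n := by
      simp only [B, eval_mul, eval_sub, eval_C]
      rw [← sum_range_pow_eq_bernoulli_sub, inv_mul_cancel_left₀ (by positivity)]
    refine ⟨C a * B.map (algebraMap ℚ R), fun k => ?_⟩
    have h : (B.map (algebraMap ℚ R)).eval (k : R) = algebraMap ℚ R (B.eval (k : ℚ)) := by
      rw [← map_natCast (algebraMap ℚ R) k, eval_map_apply]
    rw [eval_mul, eval_C, h, hB]
    simp [Finset.mul_sum]

theorem exists_coeff_prod_rescale {R : Type*} [CommRing R] [Algebra ℚ R] (E : PowerSeries R)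
    (hE : PowerSeries.constantCoeff E = 1) (n : ℕ) :
    ∃ q : R[X], ∀ k : ℕ,
      PowerSeries.coeff n (∏ j ∈ Finset.range k, PowerSeries.rescale (j : R) E) =
        q.eval (k : R) := by
  induction n using Nat.strong_induction_on with
  | _ n ih =>
    choose! q hq using ih
    -- Since E has constant term 1, adjoining the factor j = k raises the n-th coefficient by a sum
    -- over m < n of q_m(k) k^(n-m) E_(n-m), a polynomial in k. Its summatory polynomial is S; the
    -- coefficient of 1 is the value of the empty product.
    obtain ⟨S, hS⟩ := exists_eval_eq_sum_range
      (∑ m ∈ Finset.range n, q m * X ^ (n - m) * C (PowerSeries.coeff (n - m) E))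
    refine ⟨S + C (PowerSeries.coeff n 1), fun k => ?_⟩
    rw [eval_add, hS, eval_C]
    induction k with
    | zero => simp
    | succ k ihk =>
      rw [Finset.prod_range_succ, PowerSeries.coeff_mul,
        Finset.Nat.sum_antidiagonal_eq_sum_range_succ_mk, Finset.sum_range_succ, ihk,
        Finset.sum_range_succ]
      have h : PowerSeries.coeff (n - n) (PowerSeries.rescale (k : R) E) = 1 := by
        simp [PowerSeries.coeff_rescale, hE]
      rw [h, mul_one, add_right_comm, add_comm, eval_finsetSum]
      congr 1
      refine Finset.sum_congr rfl fun m hm => ?_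
      rw [hq m (Finset.mem_range.1 hm)]
      simp [PowerSeries.coeff_rescale, mul_assoc, mul_comm (PowerSeries.coeff _ E)]

theorem mk_H_replicate_one (N : ℕ) :
    PowerSeries.mk (fun t => H N (List.replicate t 1)) =
      ((∏ i ∈ Finset.range N, (1 + C (1 / ((i : ℚ) + 1)) * X) : ℚ[X]) : PowerSeries ℚ) := by
  induction N with
  | zero =>
    ext t
    rcases t with _ | t
    · simp [H]
    · simp [List.replicate_succ, H_zero_cons, PowerSeries.coeff_one]
  | succ N ih =>
    rw [Finset.prod_range_succ, Polynomial.coe_mul, ← ih]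
    ext t
    rcases t with _ | t
    · simp [H]
    · simp [List.replicate_succ, H_succ_cons, mul_add, PowerSeries.coeff_succ_mul_X,
        mul_left_comm _ (PowerSeries.C _)]

/-- The polynomial `∏_{j < k} ∏_{0 < i < p} (1 + (j / i) X)`. -/
noncomputable def blockPoly (p k : ℕ) : ℚ[X] :=
  ∏ j ∈ Finset.range k, ∏ i ∈ Finset.range (p - 1), (1 + C ((j : ℚ) / ((i : ℚ) + 1)) * X)

/-- The product `∏_{j < k} ∏_{0 < i < p} (1 + p j / i)`. -/
noncomputable def blockProd (p k : ℕ) : ℚ := (blockPoly p k).eval (p : ℚ)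

theorem prod_rescale_mk_H (p k : ℕ) :
    ∏ j ∈ Finset.range k,
      PowerSeries.rescale (j : ℚ) (PowerSeries.mk fun t => H (p - 1) (List.replicate t 1)) =
      (blockPoly p k : PowerSeries ℚ) := by
  rw [blockPoly, mk_H_replicate_one]
  simp only [← Polynomial.coeToPowerSeries.ringHom_apply (R := ℚ), map_prod]
  refine Finset.prod_congr rfl fun j _ => ?_
  refine Finset.prod_congr rfl fun i _ => ?_
  rw [Polynomial.coeToPowerSeries.ringHom_apply, Polynomial.coeToPowerSeries.ringHom_apply]
  ext t
  rcases t with _ | t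
  · simp
  · rw [PowerSeries.coeff_rescale, Polynomial.coeff_coe, Polynomial.coeff_coe]
    rcases t with _ | t
    · simp [coeff_one, div_eq_mul_inv]
    · simp [coeff_one]

/-- Every linear factor has p-integral coefficients, as 0 < i < p. The bound is uniform in k, so k
may vary with p. -/
theorem norm_coeff_blockPoly_le_one (p : Nat.Primes) (k n : ℕ) :
    ‖(((blockPoly p k).coeff n : ℚ) : ℚ_[(p : ℕ)])‖ ≤ 1 := by
  have h : (blockPoly p k).map (algebraMap ℚ ℚ_[(p : ℕ)]) ∈
      lifts (PadicInt.subring (p : ℕ)).subtype := by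
    rw [blockPoly, Polynomial.map_prod]
    refine Subsemiring.prod_mem _ fun j _ => ?_
    rw [Polynomial.map_prod]
    refine Subsemiring.prod_mem _ fun i hi => ?_
    rw [Finset.mem_range] at hi
    rw [Polynomial.map_add, Polynomial.map_mul, Polynomial.map_one, map_C, map_X]
    have hnorm : ‖(((j : ℚ) / ((i : ℚ) + 1) : ℚ) : ℚ_[(p : ℕ)])‖ ≤ 1 := by
      have h1 : ‖((i + 1 : ℕ) : ℚ_[(p : ℕ)])‖ = 1 := by
        rw [Padic.norm_natCast_eq_one_iff]
        exact (Nat.Prime.coprime_iff_not_dvd p.2).2 fun h =>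
          absurd (Nat.le_of_dvd (by omega) h) (by omega)
      push_cast at h1 ⊢
      rw [norm_div, h1, div_one]
      exact_mod_cast Padic.norm_int_le_one (p := (p : ℕ)) (j : ℤ)
    exact add_mem (one_mem _) (mul_mem (C'_mem_lifts ⟨⟨_, hnorm⟩, rfl⟩) (X_mem_lifts _))
  obtain ⟨y, hy⟩ := (lifts_iff_coeff_lifts _).1 h n
  rw [coeff_map] at hy
  have := y.2
  rw [show ((y : ℚ_[(p : ℕ)])) = _ from hy] at this
  exact this

theorem valGE_eval_sub_sum (p : Nat.Primes) (P : ℚ[X])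
    (hP : ∀ n, ‖((P.coeff n : ℚ) : ℚ_[(p : ℕ)])‖ ≤ 1) (N : ℕ) :
    ValGE p (((P.eval ((p : ℕ) : ℚ) : ℚ) : ℚ_[(p : ℕ)]) -
      ∑ n ∈ Finset.range N, ((P.coeff n : ℚ) : ℚ_[(p : ℕ)]) * ((p : ℕ) : ℚ_[(p : ℕ)]) ^ n) N := by
  have h : P.eval ((p : ℕ) : ℚ) =
      ∑ n ∈ Finset.range (P.natDegree + 1 + N), P.coeff n * ((p : ℕ) : ℚ) ^ n :=
    eval_eq_sum_range' (by omega) _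
  rw [h, add_comm (P.natDegree + 1) N, Finset.sum_range_add]
  push_cast
  rw [add_sub_cancel_left]
  refine IsUltrametricDist.norm_sum_le_of_forall_le_of_nonneg (by positivity) fun n _ => ?_
  have h1 := (valGE_zero_iff.2 (hP (N + n))).mul
    ((Padic.norm_p_zpow (p := (p : ℕ)) ((N + n : ℕ) : ℤ)).le : ValGE p _ ((N + n : ℕ) : ℤ))
  rw [zpow_natCast] at h1
  exact h1.mono (by push_cast; omega)

/-- Evaluation of elements of `mhsPoly` at a prime. -/
noncomputable def component (p : Nat.Primes) : mhsPoly →+* ℚ_[(p : ℕ)] :=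
  (Pi.evalRingHom (fun p : Nat.Primes => ℚ_[(p : ℕ)]) p).comp mhsPoly.val.toRingHom

theorem component_apply (p : Nat.Primes) (a : mhsPoly) :
    component p a = (a : PadicFamily) p := rfl

/-- The series `∑_t H_{p-1}(1, …, 1) X ^ t`. -/
noncomputable def hSeries : PowerSeries mhsPoly :=
  PowerSeries.mk fun t => ⟨hFam (List.replicate t 1), hFam_mem_mhsPoly _⟩

theorem constantCoeff_hSeries : PowerSeries.constantCoeff hSeries = 1 := by
  rw [← PowerSeries.coeff_zero_eq_constantCoeff_apply, hSeries, PowerSeries.coeff_mk]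
  exact Subtype.ext hFam_nil

theorem component_coeff_prod_rescale (p : Nat.Primes) (k n : ℕ) :
    component p (PowerSeries.coeff n
      (∏ j ∈ Finset.range k, PowerSeries.rescale (j : mhsPoly) hSeries)) =
      (((blockPoly p k).coeff n : ℚ) : ℚ_[(p : ℕ)]) := by
  rw [← Polynomial.coeff_coe, ← prod_rescale_mk_H, ← eq_ratCast (algebraMap ℚ ℚ_[(p : ℕ)]),
    ← PowerSeries.coeff_map, ← PowerSeries.coeff_map, map_prod (PowerSeries.map _),
    map_prod (PowerSeries.map _)]
  congr 1

/-- The family `f(p)`. -/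
noncomputable def polyElt (f : ℤ[X]) : mhsPoly := aeval pElt f

theorem component_polyElt (p : Nat.Primes) (f : ℤ[X]) :
    component p (polyElt f) = ((f.eval ((p : ℕ) : ℤ) : ℤ) : ℚ_[(p : ℕ)]) := by
  rw [polyElt, aeval_def, hom_eval₂]
  have h : component p pElt = ((((p : ℕ) : ℤ) : ℤ) : ℚ_[(p : ℕ)]) := by
    rw [component_apply]
    simp [pElt, pFam]
  rw [h, ← eq_intCast (Int.castRingHom _), ← eq_intCast (Int.castRingHom _) (f.eval _), eval,
    hom_eval₂]
  congr 1

/-- The family of products over `j < f(p)`. -/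
noncomputable def blockFam (f : ℤ[X]) : PadicFamily := fun p =>
  ((blockProd p (f.eval ((p : ℕ) : ℤ)).toNat : ℚ) : ℚ_[(p : ℕ)])

theorem isMhsUnitFamily_blockFam {f : ℤ[X]}
    (hf : ∀ᶠ p : Nat.Primes in cofinite, 0 ≤ f.eval ((p : ℕ) : ℤ)) :
    IsMhsUnitFamily (blockFam f) := by
  choose q hq using exists_coeff_prod_rescale hSeries constantCoeff_hSeries
  let φ : PowerSeries mhsPoly :=
    -- The property of `q 0` concerns natural number arguments only, and `polyElt f` is not one, so
    -- the constant coefficient is set to 1 outright.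
    PowerSeries.mk fun n => if n = 0 then 1 else (q n).eval (polyElt f)
  have hφ : PowerSeries.constantCoeff φ = 1 := by
    rw [← PowerSeries.coeff_zero_eq_constantCoeff_apply, PowerSeries.coeff_mk, if_pos rfl]
  have hcoeff (p : Nat.Primes) (hp : 0 ≤ f.eval ((p : ℕ) : ℤ)) (n : ℕ) :
      component p (PowerSeries.coeff n φ) =
        (((blockPoly p (f.eval ((p : ℕ) : ℤ)).toNat).coeff n : ℚ) : ℚ_[(p : ℕ)]) := by
    set k := (f.eval ((p : ℕ) : ℤ)).toNat with hk
    rw [← component_coeff_prod_rescale, PowerSeries.coeff_mk]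
    split_ifs with hn
    · subst hn
      rw [PowerSeries.coeff_zero_eq_constantCoeff_apply, map_prod]
      congr 1
      symm
      refine Finset.prod_eq_one fun j _ => ?_
      rw [← PowerSeries.coeff_zero_eq_constantCoeff_apply, PowerSeries.coeff_rescale, pow_zero,
        one_mul, PowerSeries.coeff_zero_eq_constantCoeff_apply, constantCoeff_hSeries]
    -- At the single prime p the family f(p) agrees with the natural number k, so the polynomial `q
    -- n` has the same component at both.
    · have hcast : component p (polyElt f) = component p (k : mhsPoly) := by
        have hk' : (k : ℤ) = f.eval ((p : ℕ) : ℤ) := Int.toNat_of_nonneg hp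
        rw [component_polyElt, ← hk', map_natCast, Int.cast_natCast]
      rw [hq, eval, hom_eval₂, eval, hom_eval₂]
      congr 1
  refine IsExpansion.isMhsUnitFamily (φ := φ) (fun N => ?_) hφ
  rw [mem_famFil]
  filter_upwards [hf] with p hp
  have h := valGE_eval_sub_sum p (blockPoly p (f.eval ((p : ℕ) : ℤ)).toNat)
    (norm_coeff_blockPoly_le_one p _) N
  convert h using 2
  rw [Pi.sub_apply]
  congr 1
  rw [← component_apply, eval, hom_eval₂, RingHom.comp_id, PowerSeries.eval₂_trunc_eq_sum_range]
  exact Finset.sum_congr rfl fun n _ => by rw [hcoeff p hp]; rfl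

/-- The multiples of p contribute p^k k!. In block j the other factors are pj + i = i (1 + pj/i),
contributing (p-1)! and one factor of `blockProd`. -/
theorem factorial_mul_eq (p k : ℕ) (hp : 0 < p) :
    ((p * k).factorial : ℚ) =
      k.factorial * ((p : ℚ) ^ k * ((p - 1).factorial : ℚ) ^ k) * blockProd p k := by
  obtain ⟨m, rfl⟩ : ∃ m, p = m + 1 := ⟨p - 1, by omega⟩
  induction k with
  | zero => simp [blockProd, blockPoly]
  | succ k ih =>
    have hb : blockProd (m + 1) (k + 1) = blockProd (m + 1) k *
        ∏ i ∈ Finset.range m, (1 + (k : ℚ) / ((i : ℚ) + 1) * ((m + 1 : ℕ) : ℚ)) := by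
      rw [blockProd, blockPoly, Finset.prod_range_succ, eval_mul]
      simp [blockProd, blockPoly, eval_prod]
    have hf : (((m + 1) * (k + 1)).factorial : ℚ) = ((m + 1) * k).factorial *
        ((∏ i ∈ Finset.range m, (((m + 1) * k + i + 1 : ℕ) : ℚ)) *
          (((m + 1) * k + m + 1 : ℕ) : ℚ)) := by
      rw [mul_add, mul_one, ← Finset.prod_range_add_one_eq_factorial, Finset.prod_range_add,
        Finset.prod_range_add_one_eq_factorial, Finset.prod_range_succ]
      push_cast
      ring
    have hprod : ∏ i ∈ Finset.range m, (((m + 1) * k + i + 1 : ℕ) : ℚ) = (m.factorial : ℚ) *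
        ∏ i ∈ Finset.range m, (1 + (k : ℚ) / ((i : ℚ) + 1) * ((m + 1 : ℕ) : ℚ)) := by
      rw [← Finset.prod_range_add_one_eq_factorial]
      push_cast
      rw [← Finset.prod_mul_distrib]
      refine Finset.prod_congr rfl fun i _ => ?_
      field_simp
      ring
    rw [hf, ih, hb, hprod, Nat.factorial_succ]
    push_cast
    simp only [pow_succ]
    ring

/-! ### Factorials and binomial coefficients -/

/-- The polynomial `f` is nonnegative at all but finitely many primes. -/
def EventuallyNonneg (f : ℤ[X]) : Prop :=
  ∀ᶠ p : Nat.Primes in cofinite, 0 ≤ f.eval ((p : ℕ) : ℤ)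

theorem EventuallyNonneg.add {f g : ℤ[X]} (hf : EventuallyNonneg f) (hg : EventuallyNonneg g) :
    EventuallyNonneg (f + g) := by
  unfold EventuallyNonneg at *
  filter_upwards [hf, hg] with p h1 h2
  rw [eval_add]
  exact add_nonneg h1 h2

theorem eval_eq_divX (f : ℤ[X]) (x : ℤ) : f.eval x = x * f.divX.eval x + f.coeff 0 := by
  conv_lhs => rw [← f.divX_mul_X_add]
  simp [mul_comm]

/-- A value `f.divX`(p) ≤ -1 would force f(p) ≤ f(0) - p < 0 for large p. -/
theorem EventuallyNonneg.divX {f : ℤ[X]} (hf : EventuallyNonneg f) : EventuallyNonneg f.divX := by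
  unfold EventuallyNonneg at *
  filter_upwards [hf, eventually_lt_prime (f.coeff 0).natAbs] with p h1 h2
  rw [eval_eq_divX] at h1
  by_contra! h3
  have h4 : ((p : ℕ) : ℤ) * f.divX.eval ((p : ℕ) : ℤ) ≤ ((p : ℕ) : ℤ) * (-1) :=
    mul_le_mul_of_nonneg_left (by omega) (by omega)
  omega

theorem eventually_eval_pos {f : ℤ[X]} (hf : 0 < f.leadingCoeff) :
    ∀ᶠ p : Nat.Primes in cofinite, 0 < f.eval ((p : ℕ) : ℤ) := by
  by_cases hd : 0 < f.degree
  · have hinj : Function.Injective (Int.castRingHom ℝ) := Int.cast_injective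
    have h := tendsto_atTop_of_leadingCoeff_nonneg (f.map (Int.castRingHom ℝ))
      (by rwa [degree_map_eq_of_injective hinj])
      (by rw [leadingCoeff_map_of_injective hinj]; rw [eq_intCast]; exact_mod_cast hf.le)
    have h1 : Tendsto (fun p : Nat.Primes => ((p : ℕ) : ℝ)) cofinite atTop := by
      refine tendsto_natCast_atTop_atTop.comp ?_
      rw [← Nat.cofinite_eq_atTop]
      exact Nat.Primes.coe_nat_injective.tendsto_cofinite
    filter_upwards [(h.comp h1).eventually_gt_atTop 0] with p hp
    have h2 := eval_intCast_map (Int.castRingHom ℝ) f ((p : ℕ) : ℤ)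
    simp only [Function.comp_apply, Int.cast_natCast, eq_intCast] at hp h2
    rw [h2] at hp
    exact_mod_cast hp
  · rw [eq_C_of_degree_le_zero (not_lt.1 hd)] at hf ⊢
    rw [leadingCoeff_C] at hf
    simp [hf]

theorem eventuallyNonneg_of_leadingCoeff {f : ℤ[X]} (hf : 0 ≤ f.leadingCoeff) :
    EventuallyNonneg f := by
  rcases hf.eq_or_lt with h | h
  · rw [leadingCoeff_eq_zero.1 h.symm]
    simp [EventuallyNonneg]
  · exact (eventually_eval_pos h).mono fun p hp => hp.le

/-- The family `f(p)!`. -/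
noncomputable def facFam (f : ℤ[X]) : PadicFamily := fun p =>
  ((f.eval ((p : ℕ) : ℤ)).toNat.factorial : ℚ_[(p : ℕ)])

theorem facFam_apply_ne_zero (f : ℤ[X]) (p : Nat.Primes) : facFam f p ≠ 0 := by
  simp [facFam, Nat.factorial_ne_zero]

theorem isMhsUnitFamily_intPoly {f : ℤ[X]} (hf : f ≠ 0) :
    IsMhsUnitFamily fun p => ((f.eval ((p : ℕ) : ℤ) : ℤ) : ℚ_[(p : ℕ)]) := by
  have hinj : Function.Injective (algebraMap ℤ ℚ) := Int.cast_injective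
  refine (isMhsUnitFamily_aeval ((Polynomial.map_ne_zero_iff hinj).2 hf)).congr
    (Eventually.of_forall fun p => ?_)
  rw [aeval_map_algebraMap, ← component_polyElt, component_apply, polyElt]
  have h := aeval_algHom_apply (mhsPoly.val.restrictScalars ℤ) pElt f
  exact congrFun h p

theorem facFam_add_one {f : ℤ[X]} (hf : EventuallyNonneg f) :
    ∀ᶠ p : Nat.Primes in cofinite,
      facFam (f + 1) p = (((f + 1).eval ((p : ℕ) : ℤ) : ℤ) : ℚ_[(p : ℕ)]) * facFam f p := by
  unfold EventuallyNonneg at hf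
  filter_upwards [hf] with p hp
  obtain ⟨n, hn⟩ := Int.eq_ofNat_of_zero_le hp
  simp only [facFam, eval_add, eval_one, hn]
  rw [show ((n : ℤ) + 1).toNat = n + 1 by omega, Nat.factorial_succ]
  push_cast
  simp

theorem isMhsUnitFamily_one : IsMhsUnitFamily 1 := by
  simpa using isMhsUnitFamily_algebraMap (one_ne_zero (α := ℚ))

theorem isMhsUnitFamily_facFam_C (r : ℤ) : IsMhsUnitFamily (facFam (C r)) :=
  (isMhsUnitFamily_algebraMap (c := (r.toNat.factorial : ℚ))
    (by simp [Nat.factorial_ne_zero])).congr (Eventually.of_forall fun p => by simp [facFam])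

/-- Changing the constant term of `f` changes `f(p)!` by a unit. -/
theorem isMhsUnitFamily_facFam_div {f : ℤ[X]} (hf : EventuallyNonneg f) :
    IsMhsUnitFamily (facFam f / facFam (X * f.divX)) := by
  by_cases h0 : f.divX = 0
  · have h := f.divX_mul_X_add
    rw [h0, zero_mul, zero_add] at h
    rw [h0, mul_zero, div_eq_mul_inv, ← h, ← C_0]
    exact (isMhsUnitFamily_facFam_C _).mul (isMhsUnitFamily_facFam_C _).inv
  -- Positivity keeps p · `f.divX`(p) + r nonnegative for every fixed r, even negative, so `toNat`
  -- truncates nothing as r moves one step at a time.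
  have hpos : ∀ᶠ p : Nat.Primes in cofinite, 1 ≤ f.divX.eval ((p : ℕ) : ℤ) := by
    filter_upwards [hf.divX, (isMhsUnitFamily_intPoly h0).ne_zero] with p h1 h2
    have : f.divX.eval ((p : ℕ) : ℤ) ≠ 0 := by exact_mod_cast h2
    omega
  have hnn (r : ℤ) : EventuallyNonneg (X * f.divX + C r) := by
    unfold EventuallyNonneg
    filter_upwards [hpos, eventually_lt_prime r.natAbs] with p h1 h2
    have h3 : ((p : ℕ) : ℤ) * 1 ≤ ((p : ℕ) : ℤ) * f.divX.eval ((p : ℕ) : ℤ) :=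
      mul_le_mul_of_nonneg_left h1 (by omega)
    rw [eval_add, eval_mul, eval_X, eval_C]
    omega
  have hne (r : ℤ) : X * f.divX + C r ≠ 0 := by
    intro h
    rcases eq_or_ne r 0 with rfl | hr
    · simp [h0] at h
    · have := congrArg (fun q => q.coeff 0) h
      simp [hr] at this
  have hstep (r : ℤ) : IsMhsUnitFamily
      (facFam (X * f.divX + C (r + 1)) / facFam (X * f.divX + C r)) := by
    refine (isMhsUnitFamily_intPoly (hne (r + 1))).congr ?_
    filter_upwards [facFam_add_one (hnn r)] with p hp
    rw [C_add, C_1, ← add_assoc, Pi.div_apply, hp,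
      mul_div_cancel_right₀ _ (facFam_apply_ne_zero _ p)]
  have key (r : ℤ) : IsMhsUnitFamily (facFam (X * f.divX + C r) / facFam (X * f.divX)) := by
    induction r using Int.induction_on with
    | zero =>
      refine isMhsUnitFamily_one.congr (Eventually.of_forall fun p => ?_)
      simp [facFam_apply_ne_zero]
    | succ r ih =>
      refine ((hstep r).mul ih).congr (Eventually.of_forall fun p => ?_)
      have := facFam_apply_ne_zero (X * f.divX + C (r : ℤ)) p
      simp only [Pi.mul_apply, Pi.div_apply]
      field_simp
    | pred r ih =>
      have h := hstep (-(r : ℤ) - 1)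
      rw [sub_add_cancel] at h
      refine (h.inv.mul ih).congr (Eventually.of_forall fun p => ?_)
      have := facFam_apply_ne_zero (X * f.divX + C (-(r : ℤ))) p
      simp only [Pi.mul_apply, Pi.div_apply, Pi.inv_apply]
      field_simp
  have h := key (f.coeff 0)
  rwa [mul_comm, f.divX_mul_X_add, mul_comm] at h

/-- No sign hypothesis is needed: if f(p) ≤ 0, `toNat` sends both f(p) and p f(p) to 0. -/
theorem facFam_X_mul (f : ℤ[X]) (p : Nat.Primes) :
    facFam (X * f) p = facFam f p *
      (((p : ℕ) : ℚ_[(p : ℕ)]) * (((p : ℕ) - 1).factorial : ℚ_[(p : ℕ)])) ^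
        (f.eval ((p : ℕ) : ℤ)).toNat * blockFam f p := by
  have h := congrArg (fun x : ℚ => (x : ℚ_[(p : ℕ)]))
    (factorial_mul_eq p (f.eval ((p : ℕ) : ℤ)).toNat p.2.pos)
  push_cast at h
  have hmul : (((p : ℕ) : ℤ) * f.eval ((p : ℕ) : ℤ)).toNat =
      (p : ℕ) * (f.eval ((p : ℕ) : ℤ)).toNat := by
    rcases le_total 0 (f.eval ((p : ℕ) : ℤ)) with h0 | h0
    · rw [Int.toNat_mul (by omega) h0, Int.toNat_natCast]
    · rw [Int.toNat_of_nonpos h0, Int.toNat_of_nonpos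
        (mul_nonpos_of_nonneg_of_nonpos (by omega) h0), mul_zero]
  rw [facFam, eval_mul, eval_X, hmul, h, mul_pow]
  rfl

/-- Dividing out p lowers both degrees. The powers of p (p-1)! cancel by additivity of the
exponents, and the blocks and constant-term corrections left over are units. -/
theorem isMhsUnitFamily_multinomial (N : ℕ) {g h : ℤ[X]} (hgN : g.natDegree ≤ N)
    (hhN : h.natDegree ≤ N) (hg : EventuallyNonneg g) (hh : EventuallyNonneg h) :
    IsMhsUnitFamily (facFam (g + h) / (facFam g * facFam h)) := by
  induction N generalizing g h with
  | zero =>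
    rw [eq_C_of_natDegree_le_zero hgN, eq_C_of_natDegree_le_zero hhN, ← C_add, div_eq_mul_inv]
    exact (isMhsUnitFamily_facFam_C _).mul
      ((isMhsUnitFamily_facFam_C _).mul (isMhsUnitFamily_facFam_C _)).inv
  | succ N ih =>
    have hind := ih (g := g.divX) (h := h.divX)
      (by rw [natDegree_divX_eq_natDegree_tsub_one]; omega)
      (by rw [natDegree_divX_eq_natDegree_tsub_one]; omega) hg.divX hh.divX
    have hblock := (isMhsUnitFamily_blockFam (hg.divX.add hh.divX)).mul
      ((isMhsUnitFamily_blockFam hg.divX).mul (isMhsUnitFamily_blockFam hh.divX)).inv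
    have hratio := (isMhsUnitFamily_facFam_div (hg.add hh)).mul
      ((isMhsUnitFamily_facFam_div hg).mul (isMhsUnitFamily_facFam_div hh)).inv
    refine ((hind.mul hblock).mul hratio).congr ?_
    have hb1 := (isMhsUnitFamily_blockFam hg.divX).ne_zero
    have hb2 := (isMhsUnitFamily_blockFam hh.divX).ne_zero
    have hb3 := (isMhsUnitFamily_blockFam (hg.divX.add hh.divX)).ne_zero
    filter_upwards [hg.divX, hh.divX, hb1, hb2, hb3] with p h1 h2 h3 h4 h5
    have hadd : ((g.divX + h.divX).eval ((p : ℕ) : ℤ)).toNat =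
        (g.divX.eval ((p : ℕ) : ℤ)).toNat + (h.divX.eval ((p : ℕ) : ℤ)).toNat := by
      rw [eval_add, Int.toNat_add h1 h2]
    simp only [Pi.mul_apply, Pi.div_apply, Pi.inv_apply, divX_add, facFam_X_mul, hadd, pow_add]
    have n1 := facFam_apply_ne_zero g p
    have n2 := facFam_apply_ne_zero h p
    have n3 := facFam_apply_ne_zero (g + h) p
    have n4 := facFam_apply_ne_zero g.divX p
    have n5 := facFam_apply_ne_zero h.divX p
    have n6 := facFam_apply_ne_zero (g.divX + h.divX) p
    have n7 : ((p : ℕ) : ℚ_[(p : ℕ)]) * (((p : ℕ) - 1).factorial : ℚ_[(p : ℕ)]) ≠ 0 :=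
      mul_ne_zero (prime_cast_ne_zero p) (by simp [Nat.factorial_ne_zero])
    generalize ((p : ℕ) : ℚ_[(p : ℕ)]) * (((p : ℕ) - 1).factorial : ℚ_[(p : ℕ)]) = c at *
    field_simp

/-- The family of binomial coefficients `f(p) choose g(p)`. -/
noncomputable def binomFam (f g : ℤ[X]) : PadicFamily := fun p =>
  ((Nat.choose (f.eval ((p : ℕ) : ℤ)).toNat (g.eval ((p : ℕ) : ℤ)).toNat : ℕ) : ℚ_[(p : ℕ)])

theorem isMhsUnitFamily_binomFam {f g : ℤ[X]} (hg : EventuallyNonneg g)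
    (hfg : EventuallyNonneg (f - g)) : IsMhsUnitFamily (binomFam f g) := by
  refine (isMhsUnitFamily_multinomial (max g.natDegree (f - g).natDegree) (le_max_left _ _)
    (le_max_right _ _) hg hfg).congr ?_
  filter_upwards [hg, hfg] with p h1 h2
  rw [add_sub_cancel]
  rw [eval_sub] at h2
  have h3 : (g.eval ((p : ℕ) : ℤ)).toNat ≤ (f.eval ((p : ℕ) : ℤ)).toNat := by omega
  rw [binomFam, Nat.cast_choose ℚ_[(p : ℕ)] h3]
  simp only [Pi.div_apply, Pi.mul_apply, facFam, eval_sub]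
  rw [Int.toNat_sub'']
  all_goals omega

theorem binomFam_eventually_eq_zero {f g : ℤ[X]} (hg : 0 < g.leadingCoeff)
    (hfg : (f - g).leadingCoeff < 0) : ∀ᶠ p in cofinite, binomFam f g p = 0 := by
  have h : 0 < (g - f).leadingCoeff := by
    rw [← neg_sub, leadingCoeff_neg]
    omega
  filter_upwards [eventually_eval_pos hg, eventually_eval_pos h] with p h1 h2
  rw [eval_sub] at h2
  rw [binomFam, Nat.choose_eq_zero_of_lt (by omega), Nat.cast_zero]

/-! ### Elements of the MHS algebra -/

theorem classOf_sub_sum_mem_Fil {ι : Type*} {a : PadicFamily} (ha : ∃ n : ℤ, ∀ p, ValGE p (a p) n)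
    (s : Finset ι) (u : ι → boundedFamilies) {n : ℤ}
    (h : a - ∑ i ∈ s, (u i : PadicFamily) ∈ famFil n) :
    classOf a ha - ∑ i ∈ s, Ideal.Quotient.mk nullFamilies (u i) ∈ Fil n := by
  refine ⟨a - ∑ i ∈ s, (u i : PadicFamily), ?_, ?_, h⟩
  · exact boundedFamilies.sub_mem ha (boundedFamilies.sum_mem fun i _ => (u i).2)
  · rw [classOf, ← map_sum, ← map_sub]
    congr 1
    ext1
    simp

theorem pFam_zpow_mul_hFam_mem_bounded (b : ℤ) (s : List ℕ+) :
    (pFam ^ b * hFam s : PadicFamily) ∈ boundedFamilies :=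
  boundedFamilies.mul_mem ⟨b, fun p => (Padic.norm_p_zpow (p := (p : ℕ)) b).le⟩
    ⟨0, fun p => valGE_zero_iff.2
      (norm_H_le_one p s ((p : ℕ) - 1) (Nat.sub_lt p.2.pos one_pos))⟩

/-- The element `c p ^ b H_{p-1}(s)`. -/
noncomputable def mhsTerm (c : ℚ) (b : ℤ) (s : List ℕ+) : boundedFamilies :=
  c • ⟨pFam ^ b * hFam s, pFam_zpow_mul_hFam_mem_bounded b s⟩

theorem mk_mhsTerm (c : ℚ) (b : ℤ) (s : List ℕ+) :
    Ideal.Quotient.mk nullFamilies (mhsTerm c b s) = c • (pPow b * hSum s) := rfl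

theorem pFam_zpow_mem_famFil (b : ℤ) : pFam ^ b ∈ famFil b :=
  mem_famFil.2 <| Eventually.of_forall fun p => (Padic.norm_p_zpow (p := (p : ℕ)) b).le

theorem mhsTerm_mem_famFil (c : ℚ) (b : ℤ) (s : List ℕ+) :
    (mhsTerm c b s : PadicFamily) ∈ famFil b := by
  have h := (famFil (b + 0)).smul_mem c
    (mul_mem_famFil (pFam_zpow_mem_famFil b) (hFam_mem_famFil s))
  rw [add_zero] at h
  exact h

theorem pFam_zpow_mul_zpow (a b : ℤ) : pFam ^ a * pFam ^ b = pFam ^ (a + b) := by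
  ext p
  simp only [Pi.mul_apply, Pi.pow_apply]
  exact (zpow_add₀ (prime_cast_ne_zero p) a b).symm

theorem IsMhsFamily.classOf_mem {a : PadicFamily} (h : IsMhsFamily a)
    (ha : ∃ n : ℤ, ∀ p, ValGE p (a p) n) : classOf a ha ∈ mhsAlgebra := by
  obtain ⟨m, φ, hφ⟩ := h
  have hspan (i : ℕ) : ∃ c : (ℕ × List ℕ+) →₀ ℚ,
      (c.sum fun x r => r • (pFam ^ x.1 * hFam x.2)) =
        ((PowerSeries.coeff i φ : mhsPoly) : PadicFamily) :=
    Finsupp.mem_span_range_iff_exists_finsupp.1 (PowerSeries.coeff i φ).2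
  choose c hc using hspan
  let e : ℕ × ℕ × List ℕ+ ≃ ℕ := Denumerable.eqv _
  -- Each coefficient of φ is a finite combination of p^b H_{p-1}(s); the bijection `e` lists all
  -- triples (i, b, s) in one sequence.
  let coef : ℕ → ℚ := fun k => c (e.symm k).1 (e.symm k).2
  let expo : ℕ → ℤ := fun k =>
    -- Infinitely many triples with small i + b can have coefficient zero. Giving those terms
    -- exponent k makes the exponents tend to infinity.
    if coef k = 0 then (k : ℤ) else ((e.symm k).1 : ℤ) + ((e.symm k).2.1 : ℤ) - (m : ℤ)
  let comp : ℕ → List ℕ+ := fun k => (e.symm k).2.2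
  let T : ℕ → Finset ℕ := fun M =>
    ((Finset.range M).sigma fun i => (c i).support).image fun x => e (x.1, x.2)
  have hT (M k : ℕ) : k ∈ T M ↔ (e.symm k).1 < M ∧ coef k ≠ 0 := by
    simp only [T, Finset.mem_image, Finset.mem_sigma, Finset.mem_range, Finsupp.mem_support_iff]
    constructor
    · rintro ⟨⟨i, x⟩, ⟨h1, h2⟩, rfl⟩
      simpa [coef] using ⟨h1, h2⟩
    · rintro ⟨h1, h2⟩
      exact ⟨⟨(e.symm k).1, (e.symm k).2⟩, ⟨h1, h2⟩, by simp⟩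
  have hexpo (n : ℤ) (k : ℕ) (hk : k ∉ T (n + m).toNat) (hk0 : coef k ≠ 0) : n ≤ expo k := by
    rw [hT] at hk
    simp only [expo, if_neg hk0]
    have : ¬ (e.symm k).1 < (n + m).toNat := fun h => hk ⟨h, hk0⟩
    omega
  refine ⟨coef, expo, comp, ?_, fun n => ?_⟩
  · rw [tendsto_atTop]
    intro n
    have hfin : ∀ᶠ k in atTop, k ∉ T (n + m).toNat := by
      rw [← Nat.cofinite_eq_atTop]
      exact (T _).eventually_cofinite_notMem
    filter_upwards [hfin, eventually_ge_atTop n.toNat] with k h1 h2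
    by_cases hk0 : coef k = 0
    · simp only [expo, if_pos hk0]
      omega
    · exact hexpo n k h1 hk0
  · have hsub : ∀ᶠ N in atTop, T (n + m).toNat ⊆ Finset.range N := by
      filter_upwards [eventually_gt_atTop ((T (n + m).toNat).sup id)] with N hN k hk
      exact Finset.mem_range.2 (lt_of_le_of_lt (Finset.le_sup (f := id) hk) hN)
    filter_upwards [hsub] with N hN
    simp only [← mk_mhsTerm]
    refine classOf_sub_sum_mem_Fil ha _ _ ?_
    -- The terms in `T` sum to p^(-m) times the truncation of φ at n + m, which approximates the
    -- family modulo p^n. Every other nonzero term has exponent at least n.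
    rw [← Finset.sum_sdiff hN, add_comm, ← sub_sub]
    refine sub_mem ?_ (sum_mem fun k hk => ?_)
    · set M := (n + m).toNat
      have h1 := mul_mem_famFil (pFam_zpow_mem_famFil (-m)) (hφ M)
      refine famFil_mono (n := -m + M) (by omega) ?_
      convert h1 using 1
      have hsum : ∑ k ∈ T M, (mhsTerm (coef k) (expo k) (comp k) : PadicFamily) =
          pFam ^ (-m : ℤ) * ((PowerSeries.trunc M φ).eval pElt : mhsPoly) := by
        have hev : (((PowerSeries.trunc M φ).eval pElt : mhsPoly) : PadicFamily) =
            ∑ i ∈ Finset.range M,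
              ((PowerSeries.coeff i φ : mhsPoly) : PadicFamily) * pFam ^ i := by
          rw [eval, PowerSeries.eval₂_trunc_eq_sum_range]
          simp [pElt]
        rw [hev, Finset.mul_sum, Finset.sum_image (fun x _ y _ hxy => by
          have := e.injective hxy
          rcases x with ⟨i, x⟩
          rcases y with ⟨j, y⟩
          simp only [Prod.mk.injEq] at this
          obtain ⟨rfl, rfl⟩ := this
          rfl), Finset.sum_sigma]
        refine Finset.sum_congr rfl fun i _ => ?_
        rw [← hc i, Finsupp.sum, Finset.sum_mul, Finset.mul_sum]
        refine Finset.sum_congr rfl fun x hx => ?_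
        have hcoef : coef (e (i, x)) = c i x := by simp [coef]
        have hx0 : coef (e (i, x)) ≠ 0 := by
          rw [hcoef]
          exact Finsupp.mem_support_iff.1 hx
        have hexp : expo (e (i, x)) = -(m : ℤ) + (x.1 : ℤ) + (i : ℤ) := by
          simp only [expo, if_neg hx0, Equiv.symm_apply_apply]
          ring
        have hcomp : comp (e (i, x)) = x.2 := by simp [comp]
        rw [hcoef, hexp, hcomp, ← zpow_natCast pFam i, ← zpow_natCast pFam x.1]
        change c i x • (pFam ^ (-(m : ℤ) + x.1 + i) * hFam x.2) = _
        rw [← pFam_zpow_mul_zpow, ← pFam_zpow_mul_zpow, smul_mul_assoc, mul_smul_comm]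
        congr 1
        ring
      rw [hsum, mul_sub, ← mul_assoc, ← zpow_natCast pFam m, pFam_zpow_mul_zpow, neg_add_cancel,
        zpow_zero, one_mul]
    · rw [Finset.mem_sdiff] at hk
      by_cases hk0 : coef k = 0
      · rw [hk0, mhsTerm, zero_smul]
        exact zero_mem _
      · exact famFil_mono (hexpo n k hk.2 hk0) (mhsTerm_mem_famFil _ _ _)

theorem classOf_congr {a b : PadicFamily} (ha : ∃ n : ℤ, ∀ p, ValGE p (a p) n)
    (hb : ∃ n : ℤ, ∀ p, ValGE p (b p) n) (h : ∀ᶠ p in cofinite, a p = b p) :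
    classOf a ha = classOf b hb := by
  refine Ideal.Quotient.eq.2 fun n => ?_
  filter_upwards [h] with p hp
  have h0 : a p - b p = 0 := sub_eq_zero.2 hp
  exact (show ValGE p (a p - b p) n by rw [h0]; exact ValGE.zero p n)

/-- A family with an expansion agrees almost everywhere with a bounded one. -/
theorem IsMhsFamily.exists_bounded {a : PadicFamily} (h : IsMhsFamily a) :
    ∃ b : PadicFamily, (∃ n : ℤ, ∀ p, ValGE p (b p) n) ∧ ∀ᶠ p in cofinite, a p = b p := by
  classical
  obtain ⟨m, φ, hφ⟩ := h
  have h1 := mul_mem_famFil (pFam_zpow_mem_famFil (-m)) hφ.mem_famFil_zero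
  rw [← mul_assoc, ← zpow_natCast pFam m, pFam_zpow_mul_zpow, neg_add_cancel, zpow_zero, one_mul,
    add_zero] at h1
  refine ⟨fun p => if ValGE p (a p) (-m) then a p else 0, ⟨-m, fun p => ?_⟩, ?_⟩
  · dsimp only
    split_ifs with hp
    · exact hp
    · exact ValGE.zero p _
  · filter_upwards [mem_famFil.1 h1] with p hp
    rw [if_pos hp]

theorem IsMhsUnitFamily.isMhsUnit {a : PadicFamily} (h : IsMhsUnitFamily a)
    (ha : ∃ n : ℤ, ∀ p, ValGE p (a p) n) : IsMhsUnit (classOf a ha) := by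
  -- `classOf` needs a bound at all primes, while the expansion of the inverse controls almost all
  -- of them.
  obtain ⟨b, hb, hab⟩ := h.inv_mem.exists_bounded
  refine ⟨h.mem.classOf_mem ha, classOf b hb, (h.inv_mem.congr hab).classOf_mem hb, ?_⟩
  have hmul : classOf a ha * classOf b hb =
      classOf (a * b) (boundedFamilies.mul_mem ha hb) := rfl
  have hone : (1 : QInf) = classOf 1 boundedFamilies.one_mem := rfl
  rw [hmul, hone]
  refine classOf_congr _ _ ?_
  filter_upwards [hab, h.ne_zero] with p h1 h2
  rw [Pi.mul_apply, ← h1, Pi.inv_apply, mul_inv_cancel₀ h2, Pi.one_apply]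

end MHS

theorem mainTheorem2 (f g : Polynomial ℤ) (hf : 0 < f.leadingCoeff) (hg : 0 < g.leadingCoeff) :
    (0 ≤ (f - g).leadingCoeff → MHS.IsMhsUnit (MHS.binom f g)) ∧
      ((f - g).leadingCoeff < 0 → MHS.binom f g = 0) := by
  refine ⟨fun h => ?_, fun h => ?_⟩
  -- The case f = g is included, since the zero polynomial has leading coefficient 0.
  · exact (MHS.isMhsUnitFamily_binomFam (MHS.eventuallyNonneg_of_leadingCoeff hg.le)
      (MHS.eventuallyNonneg_of_leadingCoeff h)).isMhsUnit _
  · exact MHS.classOf_congr _ MHS.boundedFamilies.zero_mem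
      (MHS.binomFam_eventually_eq_zero hg h)
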